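/- Let $C_1,\dots,C_m$ be disjoint communities of (unknown) sizes $d_i\ge 1$, let $\mu_i=1/d_i$, $D=\sum_{i=1}^m d_i$, and let $K>m$ be the exploration budget of a round. In each round $t=1,2,\dots$ a realization $\Phi_t$ assigns to each item $(i,\tau)$, $i\in[m]$, $\tau\in[K]$, the member $\Phi_t(i,\tau)$ met in the $\tau$-th exploration of $C_i$; all these members are independent and $\Phi_t(i,\tau)$ is uniform on $C_i$. A policy $\pi$ chooses the next community to explore as a function of the partial realization $\psi$, i.e. of the members met so far in each community; $\pi_K(\phi)$ is the vector of the numbers of explorations of the communities after $K$ steps, $R(\bm k,\phi)=\sum_i|\{\phi(i,\tau):\tau\le k_i\}|$ is the reward, and $r_\pi=\mathbb E[R(\pi_K(\Phi),\Phi)]$. Let $c_i(\psi)$ be the number of distinct members of $C_i$ met in $\psi$, and let $\pi^*$ be a policy that maximizes $r_\pi$. Consider the CLCB algorithm with adaptive exploration and full information feedback. It starts with $T_i=X_i=0$, $\hat\mu_i=0$. In round $t$ it uses a policy $\pi^{t}$ that in each of its $K$ steps explores a community $i\in\arg\max_{i}\,(1-c_i(\psi)\hat\mu_i)$. Ties may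 be broken in any way that depends on the past feedback, on $\psi$ and on internal randomness independent of the realizations, except that a community not yet explored in the round is preferred as long as there is one (its value $1$ is always maximal), so that every community is explored in every round. If $u_1,\dots,u_n$ are the members of $C_i$ met in the round, in this order, and $u_0$ is the last member of $C_i$ met in the previous round ($u_0=\mathrm{null}$ if $t=1$), then at the end of the round $T_i\leftarrow T_i+n-\mathbb 1\{t=1\}$, $X_i\leftarrow X_i+\sum_{x=0}^{n-1}\mathbb 1\{u_x=u_{x+1}\}$, and $\hat\mu_i\leftarrow X_i/T_i$ ($\hat\mu_i=0$ while $T_i=0$). Its regret is $\mathrm{Reg}(T)=\mathbb E\big[\sum_{t=1}^T R(\pi^*_K(\Phi_t),\Phi_t)-R(\pi^{t}_K(\Phi_t),\Phi_t)\big]$. Then the regret is bounded by a constant: there is a $C$ that depends only on $d_1,\dots,d_m$ and $K$ such that $\mathrm{Reg}(T)\le C$ for all $T$. Specifically, let $\pi^g$ be a greedy policy: it always explores a community $i\in\arg\max_i(1-\mu_ic_i(\psi))$, and its choice depends only on $(c_1(\psi),\dots,c_m(\psi))$. Let $U_{i,k}$ be the number of times that $\pi^g$ selects $C_i$ in its first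 $k-1$ steps under a realization in which the first $d_j$ explorations of each $C_j$ meet distinct members. Let $\Pi_k$ be the set of the policies that make the same choice as $\pi^g$ at every partial realization $\psi$ with $c_i(\psi)\le U_{i,k}$ for all $i$ and $c_i(\psi)<U_{i,k}$ for at least one $i$, and let $\Delta^{(k)}_{\max}=\max_{\pi\in\Pi_k}(r_{\pi^g}-r_\pi)$. For each $k$ choose any $i^*_k\in\arg\min_{i}\mu_iU_{i,k}$, and let $$\varepsilon_{i,k}=\frac{\mu_iU_{i,k}-\mu_{i^*_k}U_{i^*_k,k}}{U_{i,k}+U_{i^*_k,k}}\quad(i\ne i^*_k),\qquad \varepsilon_{i^*_k,k}=\infty .$$ Then for all $T$ $$\mathrm{Reg}(T)\le\sum_{i=1}^m\ \sum_{k=m+1}^{\min\{K,D\}}\Big(\frac{2}{\varepsilon_{i,k}^4}+1\Big)\Delta^{(k)}_{\max},$$ where $2/\infty=0$, $2/0=\infty$ and $\infty\cdot 0=0$ (so the right-hand side can be infinite if the minimizer of $\mu_iU_{i,k}$ is not unique for some $k$). -/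

import Mathlib

open scoped BigOperators ENNReal
open MeasureTheory

namespace CommunityExploration

/-- A realization: `φ i τ` is the member of community `C_i` (a set with `d i` elements) met in the
`τ`-th exploration of `C_i`, for each of the `m * K` items `(i, τ)` (`τ` is counted from `0`). -/
abbrev Realization {m : ℕ} (d : Fin m → ℕ) (K : ℕ) : Type := (i : Fin m) → Fin K → Fin (d i)

/-- A partial realization: for each community the list of the members met so far, in the order of
the explorations of that community. -/
abbrev PartialRealization {m : ℕ} (d : Fin m → ℕ) : Type := (i : Fin m) → List (Fin (d i))

/-- A policy chooses the next community to explore from the current partial realization. -/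
abbrev Policy {m : ℕ} (d : Fin m → ℕ) : Type := PartialRealization d → Fin m

variable {m : ℕ} {d : Fin m → ℕ} {K : ℕ}

/-- What is observed under `φ` when each community `C_i` has been explored `k i` times. -/
def observed (φ : Realization d K) (k : Fin m → ℕ) : PartialRealization d :=
  fun i => (List.ofFn (φ i)).take (k i)

/-- `c_i(ψ)`: the number of distinct members of `C_i` met in `ψ`. -/
def met (ψ : PartialRealization d) (i : Fin m) : ℕ := (ψ i).toFinset.card

/-- How often each community has been explored after `s` steps of policy `π` under `φ`;
`s = K` gives the exploration vector `π_K(φ)`. -/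
def explored (π : Policy d) (φ : Realization d K) : ℕ → Fin m → ℕ
  | 0 => 0
  | s + 1 => explored π φ s + Pi.single (π (observed φ (explored π φ s))) 1

/-- The reward `R(k, φ)`: the number of distinct members met. -/
def reward (k : Fin m → ℕ) (φ : Realization d K) : ℝ :=
  ∑ i, (met (observed φ k) i : ℝ)

/-- The expected reward `r_π` with budget `K`. The members `Φ(i, τ)` are independent and uniform,
so `Φ` is uniform on the finite set of all realizations; `𝔼` is the average over it. -/
noncomputable def expectedReward (K : ℕ) (π : Policy d) : ℝ :=
  𝔼 φ : Realization d K, reward (explored π φ K) φ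

/-- An optimal policy for budget `K`. -/
def IsOptimal (K : ℕ) (π : Policy d) : Prop :=
  ∀ π' : Policy d, expectedReward K π' ≤ expectedReward K π

/-- The parameter `μ_i = 1 / d_i`. -/
noncomputable def mu (d : Fin m → ℕ) (i : Fin m) : ℝ := 1 / (d i : ℝ)

/-- A greedy policy `π^g`: it explores a community that maximizes `1 - μ_i c_i(ψ)`, and its choice
depends only on the numbers of distinct members met. -/
def IsGreedy (π : Policy d) : Prop :=
  (∀ ψ j, 1 - mu d j * met ψ j ≤ 1 - mu d (π ψ) * met ψ (π ψ)) ∧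
  ∀ ψ ψ' : PartialRealization d, met ψ = met ψ' → π ψ = π ψ'

/-! ### The learning algorithm -/

/-- What the learner stores about a community with `n` members: the number of completed rounds,
the number of pairs `T_i`, the number of collisions `X_i`, and the last member met
(`none` at the beginning). -/
structure PairStats (n : ℕ) where
  rounds : ℕ
  pairs : ℕ
  collisions : ℕ
  last : Option (Fin n)

/-- The statistics before the first round. -/
def PairStats.init (n : ℕ) : PairStats n := ⟨0, 0, 0, none⟩

/-- The update at the end of a round in which the members in the list `S` were met, in this order.
With `u_0` the last member met before and `u_1, u_2, …` the elements of `S`,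
`T_i ← T_i + |S| - 1{t = 1}` and `X_i ← X_i + ∑_{x < |S|} 1{u_x = u_{x+1}}`. -/
def PairStats.update {n : ℕ} (s : PairStats n) (S : List (Fin n)) : PairStats n :=
  let u : List (Option (Fin n)) := s.last :: S.map some
  { rounds := s.rounds + 1
    pairs := s.pairs + (S.length - if s.rounds = 0 then 1 else 0)
    collisions := s.collisions + (u.zip u.tail).countP (fun p => decide (p.1 = p.2))
    last := u.getLast (List.cons_ne_nil _ _) }

/-- The feedback of the past rounds in chronological order: one partial realization per round. -/
abbrev Feedback {m : ℕ} (d : Fin m → ℕ) : Type := List (PartialRealization d)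

/-- The statistics of community `C_i` after the rounds recorded in `h`. -/
def stats (h : Feedback d) (i : Fin m) : PairStats (d i) :=
  h.foldl (fun s ψ => s.update (ψ i)) (PairStats.init (d i))

/-- The empirical mean `X_i / T_i`; it is `0`, its initial value, as long as `T_i = 0`. -/
noncomputable def muHat (h : Feedback d) (i : Fin m) : ℝ :=
  ((stats h i).collisions : ℝ) / ((stats h i).pairs : ℝ)

/-- An adaptive learning algorithm: it selects the policy of the next round from the feedback. -/
abbrev Learner {m : ℕ} (d : Fin m → ℕ) : Type := Feedback d → Policy d

/-- `A` is the adaptive CLCB algorithm with full information feedback: in each round it explores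
a community that maximizes `1 - c_i(ψ) * μ̂_i`. Ties are broken arbitrarily, except that, as long as
some community has not been explored in the current round, such a community (whose index `1` is
maximal) is preferred, so that every community is explored in every round. -/
def IsFullInfoCLCB (A : Learner d) : Prop :=
  ∀ h ψ,
    (∀ j, 1 - met ψ j * muHat h j ≤ 1 - met ψ (A h ψ) * muHat h (A h ψ)) ∧
    ((∃ j, ψ j = []) → ψ (A h ψ) = [])

/-- The feedback collected by `A` when the realizations of the successive rounds are `φs`. -/
def feedback (A : Learner d) (φs : List (Realization d K)) : Feedback d :=
  φs.foldl (fun h φ => h ++ [observed φ (explored (A h) φ K)]) []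

/-- The `T`-round adaptive regret of `A` relative to the policy `πstar`. The average is over the
independent realizations `Φ_1, …, Φ_T` of the `T` rounds. -/
noncomputable def regret (K : ℕ) (πstar : Policy d) (A : Learner d) (T : ℕ) : ℝ :=
  𝔼 Φ : Fin T → Realization d K, ∑ t : Fin T,
    (reward (explored πstar (Φ t) K) (Φ t)
      - reward (explored (A (feedback A ((List.ofFn Φ).take t))) (Φ t) K) (Φ t))

/-- The regret of an algorithm that may randomize (for instance to break ties): `A ξ` is the
algorithm with internal random seed `ξ`, which has law `ν` and is independent of the realizations. -/
noncomputable def randomizedRegret {Ξ : Type*} [MeasurableSpace Ξ] (ν : Measure Ξ)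
    (K : ℕ) (πstar : Policy d) (A : Ξ → Learner d) (T : ℕ) : ℝ :=
  ∫ ξ, regret K πstar (A ξ) T ∂ν

/-! ### The quantities in the bound -/

/-- A full realization in which the first `d i` explorations of `C_i` meet distinct members. -/
def distinctRealization (d : Fin m → ℕ) [∀ i, NeZero (d i)] (K : ℕ) : Realization d K :=
  fun i τ => Fin.ofNat (d i) τ

/-- `U_{i,k}`: how often `πg` selects `C_i` in the first `k - 1` steps under a realization whose
first explorations meet distinct members. -/
def U [∀ i, NeZero (d i)] (K : ℕ) (πg : Policy d) (k : ℕ) (i : Fin m) : ℕ :=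
  explored πg (distinctRealization d K) (k - 1) i

/-- `Π_k`: the policies that choose as `πg` does until `U_{i,k}` distinct members have been met in
every community `C_i`. -/
def policiesAgreeing [∀ i, NeZero (d i)] (K : ℕ) (πg : Policy d) (k : ℕ) : Set (Policy d) :=
  {π | ∀ ψ : PartialRealization d,
    (∀ i, met ψ i ≤ U K πg k i) → (∃ i, met ψ i < U K πg k i) → π ψ = πg ψ}

/-- `Δ^{(k)}_max`: the largest reward gap between `πg` and a policy in `Π_k`. -/
noncomputable def deltaMax [∀ i, NeZero (d i)] (K : ℕ) (πg : Policy d) (k : ℕ) : ℝ :=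
  sSup ((fun π => expectedReward K πg - expectedReward K π) '' policiesAgreeing K πg k)

/-- `i` is a minimizer of `μ_j U_{j,k}` over all communities `j`. -/
def IsArgmin [∀ i, NeZero (d i)] (K : ℕ) (πg : Policy d) (k : ℕ) (i : Fin m) : Prop :=
  ∀ j, mu d i * U K πg k i ≤ mu d j * U K πg k j

/-- `ε_{i,k}`, with `istar = i^*_k`. -/
noncomputable def eps [∀ i, NeZero (d i)] (K : ℕ) (πg : Policy d) (k : ℕ) (istar i : Fin m) :
    ℝ≥0∞ :=
  if i = istar then ⊤
  else ENNReal.ofReal ((mu d i * U K πg k i - mu d istar * U K πg k istar)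
    / ((U K πg k i : ℝ) + (U K πg k istar : ℝ)))

end CommunityExploration

/-! A policy that always explores a community with the largest chance of a new member is optimal, by
exchange: such a community stays best while others are explored, so it may as well be explored at
once (`expect_optValue_le_of_isBest`). A round thus loses reward only if the estimates `muHat`
mislead the learner, and the probability of this has to be summed over the rounds.

Concentration: each member met is uniform given the past, so a pair in `C_i` is a collision with
conditional probability `μ_i`, even though the number of pairs is random and adaptive. Hence `exp (l
X_i - (l μ_i + l² / 8) T_i)` is a supermartingale (`stepValue_expWeight_le`). Every round but the
first yields at least one pair, so after `t ≥ 1` rounds an error of size `ε` in a given direction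
has probability at most `exp (-2 ε² (t - 1))` (`prob_deviation_le`), which is summable.

Cost of an error: under `πg` the vector of numbers met runs through the chain `U K πg 1, U K πg 2,
…`, pausing when a known member is met. If a policy first disagrees with `πg` at level `k > m` of
the chain, it has the same reward as a policy in `Π_k` and loses at most `deltaMax K πg k`
(`IsGreedy.expectedReward_sub_le`). For the learner this needs, for some `i ≠ i*_k`, an estimate of
`μ` at `i*_k` too high, or at `i` too low, by `ε_{i,k}` (`exists_deviation_of_deviates`).

The constant bound must also cover ties. There integrality is used: distinct values `μ_i c_i` differ
by at least `1 / D²`, so a choice that is not greedy needs an error of at least `1 / (4 D³)`, and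
such a round costs at most the optimal reward. -/

namespace CommunityExploration

variable {m : ℕ} {d : Fin m → ℕ} {K : ℕ}

/-! ### Exploration step by step -/

/-- The partial realization after meeting `v` in one more exploration of `C_i`. -/
def extend (ψ : PartialRealization d) (i : Fin m) (v : Fin (d i)) : PartialRealization d :=
  Function.update ψ i (ψ i ++ [v])

/-- What has been observed after `s` steps of `π` under `φ`. -/
def trajectory (π : Policy d) (φ : Realization d K) (s : ℕ) : PartialRealization d :=
  observed φ (explored π φ s)

/-- The mean of `f` after one step of `π`. -/
noncomputable def stepValue (π : Policy d) (f : PartialRealization d → ℝ)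
    (ψ : PartialRealization d) : ℝ :=
  𝔼 v : Fin (d (π ψ)), f (extend ψ (π ψ) v)

lemma sum_explored (π : Policy d) (φ : Realization d K) (s : ℕ) :
    ∑ i, explored π φ s i = s := by
  induction s with
  | zero => simp [explored]
  | succ s ih => simp [explored, Finset.sum_add_distrib, ih]

lemma explored_le (π : Policy d) (φ : Realization d K) (s : ℕ) (i : Fin m) :
    explored π φ s i ≤ s := by
  calc explored π φ s i ≤ ∑ j, explored π φ s j :=
        Finset.single_le_sum (fun _ _ => Nat.zero_le _) (Finset.mem_univ i)
    _ = s := sum_explored π φ s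

lemma explored_succ (π : Policy d) (φ : Realization d K) (s : ℕ) :
    explored π φ (s + 1) = explored π φ s + Pi.single (π (trajectory π φ s)) 1 := rfl

lemma explored_le_succ (π : Policy d) (φ : Realization d K) (s : ℕ) :
    explored π φ s ≤ explored π φ (s + 1) := by
  rw [explored_succ]; exact le_self_add

lemma length_trajectory (π : Policy d) (φ : Realization d K) {s : ℕ} (hs : s ≤ K) (i : Fin m) :
    (trajectory π φ s i).length = explored π φ s i := by
  have := explored_le π φ s i
  simp only [trajectory, observed, List.length_take, List.length_ofFn]
  omega

lemma trajectory_zero (π : Policy d) (φ : Realization d K) :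
    trajectory π φ 0 = fun _ => [] := by
  ext1 i; simp [trajectory, observed, explored]

lemma observed_add_single (φ : Realization d K) (k : Fin m → ℕ) (j : Fin m) (h : k j < K) :
    observed φ (k + Pi.single j 1) = extend (observed φ k) j (φ j ⟨k j, h⟩) := by
  ext1 i
  by_cases hij : i = j
  · subst hij
    simp only [observed, extend, Pi.add_apply, Pi.single_eq_same, Function.update_self]
    rw [List.take_add_one]
    simp [h]
  · simp [observed, extend, hij]

lemma trajectory_succ (π : Policy d) (φ : Realization d K) (s : ℕ) {j : Fin m} {n : Fin K}
    (hj : π (trajectory π φ s) = j) (hn : explored π φ s j = n) :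
    trajectory π φ (s + 1) = extend (trajectory π φ s) j (φ j n) := by
  have h : explored π φ s j < K := hn ▸ n.2
  have e : n = ⟨explored π φ s j, h⟩ := Fin.ext hn.symm
  rw [e, trajectory, explored_succ, hj, observed_add_single _ _ _ h, trajectory]

lemma exists_trajectory_succ (π : Policy d) (φ : Realization d K) {s : ℕ} (hs : s < K) :
    ∃ v, trajectory π φ (s + 1) = extend (trajectory π φ s) (π (trajectory π φ s)) v :=
  ⟨_, trajectory_succ π φ s (n := ⟨_, (explored_le π φ s _).trans_lt hs⟩) rfl rfl⟩

/-! ### The law of the observations -/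

/-- `φ` with the member met in the `n`-th exploration of `C_j` replaced by `v`. -/
def resample (φ : Realization d K) (j : Fin m) (n : Fin K) (v : Fin (d j)) : Realization d K :=
  Function.update φ j (Function.update (φ j) n v)

lemma resample_apply_self (φ : Realization d K) (j : Fin m) (n : Fin K) (v : Fin (d j)) :
    resample φ j n v j n = v := by simp [resample]

lemma resample_resample (φ : Realization d K) (j : Fin m) (n : Fin K) (v w : Fin (d j)) :
    resample (resample φ j n v) j n w = resample φ j n w := by simp [resample]

lemma resample_eq_self (φ : Realization d K) (j : Fin m) (n : Fin K) :
    resample φ j n (φ j n) = φ := by simp [resample]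

lemma expect_resample [∀ i, NeZero (d i)] (j : Fin m) (n : Fin K) (G : Realization d K → ℝ) :
    𝔼 φ, 𝔼 v, G (resample φ j n v) = 𝔼 φ, G φ := by
  have h : 𝔼 x : Realization d K × Fin (d j), G (resample x.1 j n x.2)
      = 𝔼 x : Realization d K × Fin (d j), G x.1 := by
    -- Exchanging `v` with the entry that it replaces is a bijection, so it preserves the uniform
    -- law.
    let e : Realization d K × Fin (d j) → Realization d K × Fin (d j) :=
      fun x => (resample x.1 j n x.2, x.1 j n)
    have he : Function.Involutive e := fun x => by
      simp [e, resample_apply_self, resample_resample, resample_eq_self]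
    exact Fintype.expect_bijective e he.bijective _ _ fun x => rfl
  rw [← Finset.univ_product_univ, Finset.expect_product, Finset.expect_product] at h
  simpa using h

lemma observed_resample (φ : Realization d K) (j : Fin m) (n : Fin K) (v : Fin (d j))
    (k : Fin m → ℕ) (hk : k j ≤ n) : observed (resample φ j n v) k = observed φ k := by
  ext1 i
  by_cases hij : i = j
  · subst hij
    refine List.ext_getElem (by simp [observed]) fun a h1 h2 => ?_
    have ha : a < k i := by simp [observed] at h1; omega
    have hne : (⟨a, by omega⟩ : Fin K) ≠ n := fun h => by
      have := congrArg Fin.val h; simp at this; omega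
    simp [observed, resample, Function.update_of_ne hne]
  · simp [observed, resample, hij]

/-- Until the item `(j, n)` is explored, no choice of `π` can depend on its outcome. -/
lemma explored_resample (π : Policy d) (φ : Realization d K) (j : Fin m) (n : Fin K)
    (v : Fin (d j)) {s : ℕ} (h : explored π φ s j ≤ n) :
    explored π (resample φ j n v) s = explored π φ s := by
  induction s with
  | zero => rfl
  | succ s ih =>
    have h' : explored π φ s j ≤ n := (explored_le_succ π φ s j).trans h
    rw [explored_succ, explored_succ, trajectory, ih h', observed_resample _ _ _ _ _ h', trajectory]

lemma explored_resample_apply_eq_iff (π : Policy d) (φ : Realization d K) (j : Fin m) (n : Fin K)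
    (v : Fin (d j)) {s : ℕ} :
    explored π (resample φ j n v) s j = n ↔ explored π φ s j = n := by
  refine ⟨fun h => ?_, fun h => by rw [explored_resample π φ j n v h.le, h]⟩
  have := explored_resample π (resample φ j n v) j n (φ j n) h.le
  rw [resample_resample, resample_eq_self] at this
  rw [this, h]

/-- The item explored in step `s` is fresh, so its outcome can be resampled without changing the
trajectory before it. -/
lemma expect_trajectory_succ [∀ i, NeZero (d i)] (π : Policy d) (f : PartialRealization d → ℝ)
    {s : ℕ} (hs : s < K) :
    𝔼 φ : Realization d K, f (trajectory π φ (s + 1))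
      = 𝔼 φ : Realization d K, stepValue π f (trajectory π φ s) := by
  classical
  -- Split according to the item `(j, n)` that is explored next.
  have key : ∀ H : Realization d K → ℝ, 𝔼 φ, H φ = ∑ j : Fin m, ∑ n : Fin K, 𝔼 φ,
      if π (trajectory π φ s) = j ∧ explored π φ s j = n then H φ else 0 := by
    intro H
    simp_rw [← Finset.expect_sum_comm]
    refine Finset.expect_congr rfl fun φ _ => ?_
    rw [Finset.sum_eq_single (π (trajectory π φ s))]
    · rw [Finset.sum_eq_single
        ⟨explored π φ s (π (trajectory π φ s)), (explored_le π φ s _).trans_lt hs⟩]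
      · simp
      · intro n _ hn
        rw [if_neg]
        rintro ⟨-, h⟩
        exact hn (Fin.ext h.symm)
      · simp
    · intro j _ hj
      exact Finset.sum_eq_zero fun n _ => if_neg fun h => hj h.1.symm
    · simp
  rw [key, key (fun φ => stepValue π f (trajectory π φ s))]
  refine Finset.sum_congr rfl fun j _ => Finset.sum_congr rfl fun n _ => ?_
  rw [← expect_resample j n]
  refine Finset.expect_congr rfl fun φ _ => ?_
  by_cases h : explored π φ s j = n
  · have htr : ∀ v, trajectory π (resample φ j n v) s = trajectory π φ s := fun v => by
      rw [trajectory, explored_resample π φ j n v h.le, observed_resample _ _ _ _ _ h.le, trajectory]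
    by_cases hj : π (trajectory π φ s) = j
    · simp only [htr, explored_resample_apply_eq_iff, h, hj, and_self, if_true]
      subst hj
      refine Finset.expect_congr rfl fun v _ => ?_
      rw [trajectory_succ π _ s (congrArg π (htr v))
        ((explored_resample_apply_eq_iff π φ _ n v).2 h), htr, resample_apply_self]
    · simp [htr, hj]
  · simp [explored_resample_apply_eq_iff, h]

/-- Averages over realizations become iterates of a one-step operator, on which the exchange
argument and the supermartingale work by induction. -/
lemma expect_trajectory [∀ i, NeZero (d i)] (π : Policy d) (f : PartialRealization d → ℝ)
    {s : ℕ} (hs : s ≤ K) :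
    𝔼 φ : Realization d K, f (trajectory π φ s) = (stepValue π)^[s] f (fun _ => []) := by
  induction s generalizing f with
  | zero => simp [trajectory_zero]
  | succ s ih =>
    rw [expect_trajectory_succ π f (by omega), ih _ (by omega), Function.iterate_succ_apply]

lemma stepValue_mono (π : Policy d) {f g : PartialRealization d → ℝ} (h : f ≤ g) :
    stepValue π f ≤ stepValue π g :=
  fun _ => Finset.expect_le_expect fun _ _ => h _

lemma iterate_stepValue_le (π : Policy d) {f : PartialRealization d → ℝ} (h : stepValue π f ≤ f)
    (n : ℕ) : (stepValue π)^[n] f ≤ f := by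
  induction n with
  | zero => exact le_rfl
  | succ n ih =>
    rw [Function.iterate_succ_apply']
    exact (stepValue_mono π ih).trans h

/-! ### Optimality of greedy policies -/

/-- The number of distinct members met. -/
def totalMet (ψ : PartialRealization d) : ℝ := ∑ i, (met ψ i : ℝ)

lemma expectedReward_eq [∀ i, NeZero (d i)] (K : ℕ) (π : Policy d) :
    expectedReward K π = (stepValue π)^[K] totalMet (fun _ => []) :=
  expect_trajectory π totalMet le_rfl

lemma met_extend_self (ψ : PartialRealization d) (i : Fin m) (v : Fin (d i)) :
    met (extend ψ i v) i = met ψ i + if v ∈ ψ i then 0 else 1 := by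
  have : (ψ i ++ [v]).toFinset = insert v (ψ i).toFinset := by ext; simp
  simp only [met, extend, Function.update_self, this, Finset.card_insert_eq_ite, List.mem_toFinset]
  split_ifs <;> rfl

lemma met_extend_of_ne (ψ : PartialRealization d) {i j : Fin m} (v : Fin (d i)) (h : j ≠ i) :
    met (extend ψ i v) j = met ψ j := by
  simp [met, extend, h]

lemma met_extend (ψ : PartialRealization d) (i : Fin m) (v : Fin (d i)) :
    met (extend ψ i v) = met ψ + Pi.single i (if v ∈ ψ i then 0 else 1) := by
  ext j
  by_cases h : j = i
  · subst h; simp [met_extend_self]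
  · simp [met_extend_of_ne ψ v h, h]

lemma met_le_met_extend (ψ : PartialRealization d) (i : Fin m) (v : Fin (d i)) :
    met ψ ≤ met (extend ψ i v) := by
  rw [met_extend]; exact le_self_add

lemma met_le (ψ : PartialRealization d) (i : Fin m) : met ψ i ≤ d i := by
  simpa [met] using Finset.card_le_univ (ψ i).toFinset

lemma extend_comm (ψ : PartialRealization d) {i j : Fin m} (h : i ≠ j) (v : Fin (d i))
    (w : Fin (d j)) : extend (extend ψ i v) j w = extend (extend ψ j w) i v := by
  unfold extend
  rw [Function.update_of_ne h, Function.update_of_ne h.symm, Function.update_comm h]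

lemma expect_totalMet_extend [∀ i, NeZero (d i)] (ψ : PartialRealization d) (i : Fin m) :
    𝔼 v, totalMet (extend ψ i v) = totalMet ψ + (1 - mu d i * met ψ i) := by
  have h : ∀ v, totalMet (extend ψ i v) = totalMet ψ + (1 - if v ∈ ψ i then (1 : ℝ) else 0) := by
    intro v
    simp only [totalMet, met_extend, Pi.add_apply, Nat.cast_add, Finset.sum_add_distrib]
    congr 1
    rw [← Nat.cast_sum, Finset.sum_pi_single', if_pos (Finset.mem_univ i)]
    split_ifs <;> simp
  have h2 : 𝔼 v : Fin (d i), (if v ∈ ψ i then (1 : ℝ) else 0) = mu d i * met ψ i := by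
    rw [Fintype.expect_eq_sum_div_card, Finset.sum_boole]
    have : Finset.univ.filter (fun v => v ∈ ψ i) = (ψ i).toFinset := by ext; simp
    rw [this, mu, met, Fintype.card_fin]; ring
  simp_rw [h]
  rw [Finset.expect_add_distrib, Finset.expect_sub_distrib, h2, Fintype.expect_const,
    Fintype.expect_const]

/-- The largest mean number of distinct members met after `n` more steps. -/
noncomputable def optValue : ℕ → PartialRealization d → ℝ
  | 0, ψ => totalMet ψ
  | n + 1, ψ => ⨆ i, 𝔼 v : Fin (d i), optValue n (extend ψ i v)

lemma expect_optValue_le (n : ℕ) (ψ : PartialRealization d) (i : Fin m) :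
    𝔼 v : Fin (d i), optValue n (extend ψ i v) ≤ optValue (n + 1) ψ :=
  le_ciSup (f := fun i => 𝔼 v : Fin (d i), optValue n (extend ψ i v))
    (Set.finite_range _).bddAbove i

/-- `C_g` maximizes the probability of meeting a new member. -/
def IsBest (ψ : PartialRealization d) (g : Fin m) : Prop :=
  ∀ j, mu d g * met ψ g ≤ mu d j * met ψ j

lemma mu_nonneg (i : Fin m) : 0 ≤ mu d i := by unfold mu; positivity

lemma IsBest.extend {ψ : PartialRealization d} {g : Fin m} (h : IsBest ψ g) {i : Fin m}
    (hi : g ≠ i) (v : Fin (d i)) : IsBest (extend ψ i v) g := fun j => by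
  rw [met_extend_of_ne ψ v hi]
  refine (h j).trans (mul_le_mul_of_nonneg_left ?_ (mu_nonneg j))
  exact_mod_cast met_le_met_extend ψ i v j

/-- After an exploration of `i ≠ g`, `g` is still best, so by induction it may come next; the two
explorations commute, and starting with `g` leaves the second choice free. -/
lemma expect_optValue_le_of_isBest [∀ i, NeZero (d i)] (n : ℕ) (ψ : PartialRealization d)
    {g : Fin m} (hg : IsBest ψ g) (i : Fin m) :
    𝔼 v : Fin (d i), optValue n (extend ψ i v) ≤ 𝔼 v : Fin (d g), optValue n (extend ψ g v) := by
  induction n generalizing ψ g i with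
  | zero =>
    simp only [optValue, expect_totalMet_extend]
    linarith [hg i]
  | succ n ih =>
    by_cases hi : g = i
    · rw [hi]
    have : Nonempty (Fin m) := ⟨g⟩
    calc 𝔼 v : Fin (d i), optValue (n + 1) (extend ψ i v)
        ≤ 𝔼 v : Fin (d i), 𝔼 w : Fin (d g), optValue n (extend (extend ψ i v) g w) :=
          Finset.expect_le_expect fun v _ => ciSup_le fun j => ih _ (hg.extend hi v) j
      _ = 𝔼 w : Fin (d g), 𝔼 v : Fin (d i), optValue n (extend (extend ψ g w) i v) := by
          rw [Finset.expect_comm]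
          simp_rw [extend_comm ψ (Ne.symm hi)]
      _ ≤ _ := Finset.expect_le_expect fun w _ => expect_optValue_le _ _ _

lemma iterate_stepValue_le_optValue (π : Policy d) (n : ℕ) :
    (stepValue π)^[n] totalMet ≤ optValue n := by
  induction n with
  | zero => exact fun _ => le_rfl
  | succ n ih =>
    rw [Function.iterate_succ_apply']
    exact (stepValue_mono π ih).trans fun ψ => expect_optValue_le n ψ (π ψ)

lemma iterate_stepValue_eq_optValue [∀ i, NeZero (d i)] {π : Policy d}
    (hπ : ∀ ψ, IsBest ψ (π ψ)) (n : ℕ) : (stepValue π)^[n] totalMet = optValue n := by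
  induction n with
  | zero => rfl
  | succ n ih =>
    rw [Function.iterate_succ_apply', ih]
    ext ψ
    have : Nonempty (Fin m) := ⟨π ψ⟩
    exact le_antisymm (expect_optValue_le n ψ (π ψ))
      (ciSup_le fun j => expect_optValue_le_of_isBest n ψ (hπ ψ) j)

lemma isOptimal_of_isBest [∀ i, NeZero (d i)] (K : ℕ) {π : Policy d}
    (hπ : ∀ ψ, IsBest ψ (π ψ)) : IsOptimal K π := fun π' => by
  rw [expectedReward_eq, expectedReward_eq, iterate_stepValue_eq_optValue hπ]
  exact iterate_stepValue_le_optValue π' K _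

lemma IsGreedy.isBest {π : Policy d} (h : IsGreedy π) (ψ : PartialRealization d) :
    IsBest ψ (π ψ) := fun j => by linarith [h.1 ψ j]

/-! ### Concentration of the empirical collision frequencies -/

/-- Hoeffding's lemma for a Bernoulli variable. -/
lemma bernoulli_mgf_le {p : ℝ} (h0 : 0 ≤ p) (h1 : p ≤ 1) (l : ℝ) :
    1 + p * (Real.exp l - 1) ≤ Real.exp (l * p + l ^ 2 / 8) := by
  -- The identity under this two-point law lies in `[0, 1]`, hence is sub-Gaussian with parameter `1
  -- / 4`, which gives `l ^ 2 / 8`.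
  let ν : Measure ℝ := ENNReal.ofReal (1 - p) • Measure.dirac 0 + ENNReal.ofReal p • Measure.dirac 1
  have hν : IsProbabilityMeasure ν := ⟨by
    simp only [ν, Measure.coe_add, Measure.coe_smul, Pi.add_apply, Pi.smul_apply, measure_univ,
      smul_eq_mul, mul_one]
    rw [← ENNReal.ofReal_add (by linarith) h0]; simp⟩
  have hint : ∀ f : ℝ → ℝ, ∫ x, f x ∂ν = (1 - p) * f 0 + p * f 1 := by
    intro f
    have hi : ∀ a : ℝ, Integrable f (Measure.dirac a) := fun a =>
      integrable_dirac (by simp)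
    rw [integral_add_measure ((hi 0).smul_measure ENNReal.ofReal_ne_top)
      ((hi 1).smul_measure ENNReal.ofReal_ne_top), integral_smul_measure, integral_smul_measure,
      integral_dirac, integral_dirac, ENNReal.toReal_ofReal (by linarith),
      ENNReal.toReal_ofReal h0, smul_eq_mul, smul_eq_mul]
  have hb : ∀ᵐ x ∂ν, id x ∈ Set.Icc (0 : ℝ) 1 := by
    simp only [ν, ae_add_measure_iff]
    constructor <;> refine Measure.ae_smul_measure ?_ _ <;> rw [ae_dirac_eq] <;> simp
  have h := (ProbabilityTheory.hasSubgaussianMGF_of_mem_Icc (X := id) aemeasurable_id hb).mgf_le l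
  rw [ProbabilityTheory.mgf, hint, hint] at h
  norm_num at h
  have e : Real.exp (l * p) * ((1 - p) * Real.exp (-(l * p)) + p * Real.exp (l * (1 - p)))
      = 1 + p * (Real.exp l - 1) := by
    have h2 : Real.exp (l * p) * Real.exp (-(l * p)) = 1 := by rw [← Real.exp_add]; simp
    have h3 : Real.exp (l * p) * Real.exp (l * (1 - p)) = Real.exp l := by
      rw [← Real.exp_add]; ring_nf
    linear_combination (1 - p) * h2 + p * h3
  rw [← e, Real.exp_add]
  refine mul_le_mul_of_nonneg_left (h.trans (le_of_eq ?_)) (Real.exp_nonneg _)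
  congr 1; ring

lemma mu_le_one (i : Fin m) : mu d i ≤ 1 := by
  unfold mu
  rcases Nat.eq_zero_or_pos (d i) with h | h
  · simp [h]
  · exact div_le_one_of_le₀ (by exact_mod_cast h) (by positivity)

/-- The factor by which one pair changes the exponential supermartingale has mean at most `1`. -/
lemma expect_exp_collision_le [∀ i, NeZero (d i)] (i : Fin m) (u : Fin (d i)) (l : ℝ) :
    𝔼 v : Fin (d i), Real.exp (l * (if u = v then 1 else 0) - (l * mu d i + l ^ 2 / 8)) ≤ 1 := by
  have h : ∀ v : Fin (d i), Real.exp (l * (if u = v then 1 else 0) - (l * mu d i + l ^ 2 / 8))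
      = Real.exp (-(l * mu d i + l ^ 2 / 8))
        * (1 + (if u = v then 1 else 0) * (Real.exp l - 1)) := by
    intro v
    rw [sub_eq_neg_add, Real.exp_add]
    split_ifs <;> simp
  have h2 : 𝔼 v : Fin (d i), (if u = v then (1 : ℝ) else 0) = mu d i := by
    rw [Fintype.expect_eq_sum_div_card, mu]; simp
  simp_rw [h]
  rw [← Finset.mul_expect, Finset.expect_add_distrib, ← Finset.expect_mul, h2,
    Fintype.expect_const, Real.exp_neg, inv_mul_le_one₀ (Real.exp_pos _)]
  exact bernoulli_mgf_le (mu_nonneg i) (mu_le_one i) l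

lemma countP_zip_tail_concat {α : Type*} (p : α × α → Bool) (l : List α) (hl : l ≠ []) (x : α) :
    ((l ++ [x]).zip (l ++ [x]).tail).countP p
      = (l.zip l.tail).countP p + (p (l.getLast hl, x)).toNat := by
  induction l with
  | nil => exact absurd rfl hl
  | cons a l ih =>
    cases l with
    | nil =>
      simp only [List.cons_append, List.nil_append, List.tail_cons, List.zip_cons_cons,
        List.countP_cons, List.getLast_singleton]
      cases p (a, x) <;> rfl
    | cons b l =>
      have := ih (by simp)
      simp only [List.cons_append, List.tail_cons, List.zip_cons_cons, List.countP_cons,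
        List.getLast_cons_cons] at this ⊢
      omega

/-! ### Effect of one more member on the pair statistics -/

namespace PairStats

variable {n : ℕ}

lemma update_concat_collisions (s : PairStats n) (S : List (Fin n)) (v : Fin n) :
    (s.update (S ++ [v])).collisions
      = (s.update S).collisions + if (s.update S).last = some v then 1 else 0 := by
  have := countP_zip_tail_concat (fun p : Option (Fin n) × Option (Fin n) => decide (p.1 = p.2))
    (s.last :: S.map some) (List.cons_ne_nil _ _) (some v)
  simp only [update, List.map_append, List.map_cons, List.map_nil, add_assoc]
  simp only [List.cons_append] at this
  rw [this]
  congr 2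
  split_ifs with h <;> simp [h]

lemma update_nil_last (s : PairStats n) : (s.update []).last = s.last := by simp [update]

lemma update_nil_pairs (s : PairStats n) : (s.update []).pairs = s.pairs := by simp [update]

lemma update_nil_collisions (s : PairStats n) : (s.update []).collisions = s.collisions := by
  simp [update]

lemma update_last_ne_none (s : PairStats n) {S : List (Fin n)} (hS : S ≠ []) :
    (s.update S).last ≠ none := by
  simp only [update]
  rw [List.getLast_cons (by simpa using hS), List.getLast_map]
  simp

lemma update_concat_pairs (s : PairStats n) (S : List (Fin n)) (v : Fin n)
    (h : s.rounds ≠ 0 ∨ S ≠ []) : (s.update (S ++ [v])).pairs = (s.update S).pairs + 1 := by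
  simp only [update, List.length_append, List.length_singleton]
  rcases h with h | h
  · simp [h, add_assoc]
  · have := List.length_pos_iff.2 h
    split_ifs <;> omega

/-- The statistics are consistent: there is a last member unless no round has been completed, and
each completed round but the first has contributed a pair. -/
structure Valid (s : PairStats n) : Prop where
  last_eq_none_iff : s.last = none ↔ s.rounds = 0
  rounds_le : s.rounds ≤ s.pairs + 1

lemma valid_init : (init n).Valid := ⟨by simp [init], by simp [init]⟩

lemma Valid.update {s : PairStats n} (hs : s.Valid) {S : List (Fin n)} (hS : S ≠ []) :
    (s.update S).Valid := by
  refine ⟨⟨fun h => absurd h (s.update_last_ne_none hS), fun h => by simp [PairStats.update] at h⟩,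
    ?_⟩
  have := List.length_pos_iff.2 hS
  have := hs.rounds_le
  simp only [PairStats.update]
  split_ifs <;> omega

/-- The exponential supermartingale. -/
noncomputable def expWeight (l c : ℝ) (s : PairStats n) : ℝ :=
  Real.exp (l * s.collisions - c * s.pairs)

end PairStats

open PairStats

/-- An exploration of `C_i` multiplies the weight by a factor of mean at most `1`; any other
exploration leaves it unchanged. -/
lemma stepValue_expWeight_le [∀ i, NeZero (d i)] (π : Policy d) (i : Fin m) (l : ℝ)
    {s : PairStats (d i)} (hs : s.Valid) :
    stepValue π (fun ψ => expWeight l (l * mu d i + l ^ 2 / 8) (s.update (ψ i)))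
      ≤ fun ψ => expWeight l (l * mu d i + l ^ 2 / 8) (s.update (ψ i)) := by
  intro ψ
  unfold stepValue
  by_cases hi : i = π ψ
  · subst hi
    simp only [extend, Function.update_self]
    by_cases h : s.rounds ≠ 0 ∨ ψ (π ψ) ≠ []
    · have hlast : (s.update (ψ (π ψ))).last ≠ none := by
        by_cases hS : ψ (π ψ) = []
        · rw [hS, update_nil_last, Ne, hs.last_eq_none_iff]; tauto
        · exact update_last_ne_none _ hS
      obtain ⟨u, hu⟩ := Option.ne_none_iff_exists'.1 hlast
      have e : ∀ v, expWeight l (l * mu d (π ψ) + l ^ 2 / 8) (s.update (ψ (π ψ) ++ [v]))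
          = expWeight l (l * mu d (π ψ) + l ^ 2 / 8) (s.update (ψ (π ψ))) *
            Real.exp (l * (if u = v then 1 else 0) - (l * mu d (π ψ) + l ^ 2 / 8)) := by
        intro v
        rw [expWeight, expWeight, update_concat_collisions, update_concat_pairs s _ v h, hu,
          ← Real.exp_add]
        congr 1
        simp only [Option.some.injEq]
        push_cast
        ring
      simp_rw [e]
      rw [← Finset.mul_expect]
      exact mul_le_of_le_one_right (Real.exp_nonneg _) (expect_exp_collision_le _ u l)
    -- The very first member of the first round is preceded by `none`: it adds neither a pair nor a
    -- collision.
    · push Not at h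
      have hl : s.last = none := hs.last_eq_none_iff.2 h.1
      refine Finset.expect_le Finset.univ_nonempty fun v _ => le_of_eq ?_
      simp only [expWeight, h.2, List.nil_append]
      congr 2 <;> simp [update, hl, h.1]
  · have e : ∀ v, extend ψ (π ψ) v i = ψ i := fun v => by simp [extend, hi]
    simp only [e, Fintype.expect_const, le_refl]

/-! ### The feedback of a learner -/

/-- An unexplored community is chosen as long as there is one. -/
def PrefersUnexplored (π : Policy d) : Prop :=
  ∀ ψ : PartialRealization d, (∃ j, ψ j = []) → ψ (π ψ) = []

/-- Before step `m` some community is unexplored, so no community is repeated; `m` explorations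
without repetition cover all `m` communities. -/
lemma explored_eq_one {π : Policy d} (h : PrefersUnexplored π) (φ : Realization d K)
    (hK : m ≤ K) : explored π φ m = 1 := by
  have hle : ∀ s ≤ m, ∀ i, explored π φ s i ≤ 1 := by
    intro s
    induction s with
    | zero => simp [explored]
    | succ s ih =>
      intro hs i
      have ih := ih (by omega)
      have hex : ∃ j, trajectory π φ s j = [] := by
        by_contra! hne
        have : ∑ i : Fin m, 1 ≤ ∑ i, explored π φ s i := Finset.sum_le_sum fun j _ => by
          rw [← length_trajectory π φ (by omega) j]
          exact List.length_pos_iff.2 (hne j)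
        simp [sum_explored] at this
        omega
      have h0 := congrArg List.length (h _ hex)
      rw [length_trajectory π φ (by omega)] at h0
      rw [explored_succ, Pi.add_apply]
      by_cases hi : i = π (trajectory π φ s)
      · rw [hi, h0]; simp
      · simpa [hi] using ih i
  have hs : ∑ i, explored π φ m i = ∑ i : Fin m, 1 := by simp [sum_explored]
  ext i
  exact (Finset.sum_eq_sum_iff_of_le fun i _ => hle m le_rfl i).1 hs i (Finset.mem_univ i)

lemma explored_mono (π : Policy d) (φ : Realization d K) : Monotone (explored π φ) :=
  monotone_nat_of_le_succ (explored_le_succ π φ)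

lemma trajectory_ne_nil {π : Policy d} (h : PrefersUnexplored π) (φ : Realization d K)
    {s : ℕ} (hm : m ≤ s) (hs : s ≤ K) (i : Fin m) : trajectory π φ s i ≠ [] := by
  rw [← List.length_pos_iff, length_trajectory π φ hs]
  calc 0 < explored π φ m i := by rw [explored_eq_one h φ (hm.trans hs)]; simp
    _ ≤ _ := explored_mono π φ hm i

lemma IsFullInfoCLCB.prefersUnexplored {A : Learner d} (hA : IsFullInfoCLCB A) (h : Feedback d) :
    PrefersUnexplored (A h) := fun ψ => (hA h ψ).2

lemma stats_concat (h : Feedback d) (ψ : PartialRealization d) (i : Fin m) :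
    stats (h ++ [ψ]) i = (stats h i).update (ψ i) := by
  simp [stats]

lemma feedback_concat (A : Learner d) (φs : List (Realization d K)) (φ : Realization d K) :
    feedback A (φs ++ [φ]) = feedback A φs ++ [trajectory (A (feedback A φs)) φ K] := by
  simp [feedback, trajectory]

lemma stats_feedback_valid {A : Learner d} (hA : IsFullInfoCLCB A) (hK : m ≤ K) (i : Fin m)
    (φs : List (Realization d K)) :
    (stats (feedback A φs) i).Valid ∧ (stats (feedback A φs) i).rounds = φs.length := by
  induction φs using List.reverseRecOn with
  | nil => exact ⟨valid_init, rfl⟩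
  | append_singleton φs φ ih =>
    rw [feedback_concat, stats_concat]
    refine ⟨ih.1.update (trajectory_ne_nil (hA.prefersUnexplored _) φ hK le_rfl i), ?_⟩
    simp [PairStats.update, ih.2]

lemma expect_fin_succ [∀ i, NeZero (d i)] (T : ℕ)
    (F : (Fin T → Realization d K) → Realization d K → ℝ) :
    𝔼 Φ : Fin (T + 1) → Realization d K, F (fun t => Φ t.castSucc) (Φ (Fin.last T))
      = 𝔼 Φ : Fin T → Realization d K, 𝔼 φ, F Φ φ := by
  rw [← Fintype.expect_equiv (Fin.snocEquiv fun _ : Fin (T + 1) => Realization d K)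
    (fun x => F x.2 x.1) _ fun x => by simp [Fin.snocEquiv],
    ← Finset.univ_product_univ, Finset.expect_product, Finset.expect_comm]

lemma expect_expWeight_le_one [∀ i, NeZero (d i)] {A : Learner d} (hA : IsFullInfoCLCB A)
    (hK : m ≤ K) (i : Fin m) (l : ℝ) (T : ℕ) :
    𝔼 Φ : Fin T → Realization d K,
      expWeight l (l * mu d i + l ^ 2 / 8) (stats (feedback A (List.ofFn Φ)) i) ≤ 1 := by
  induction T with
  | zero => simp [feedback, stats, PairStats.init, expWeight]
  | succ T ih =>
    have e := expect_fin_succ T fun (Φ : Fin T → Realization d K) φ =>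
      expWeight l (l * mu d i + l ^ 2 / 8) (stats (feedback A (List.ofFn Φ ++ [φ])) i)
    simp_rw [List.ofFn_succ', List.concat_eq_append]
    rw [e]
    refine le_trans (Finset.expect_le_expect fun Φ _ => ?_) ih
    simp_rw [feedback_concat, stats_concat]
    rw [expect_trajectory (A (feedback A (List.ofFn Φ))) (fun ψ => expWeight l
      (l * mu d i + l ^ 2 / 8) ((stats (feedback A (List.ofFn Φ)) i).update (ψ i))) le_rfl]
    refine (iterate_stepValue_le _ (stepValue_expWeight_le _ i l
      (stats_feedback_valid hA hK i _).1) K _).trans (le_of_eq ?_)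
    simp only [expWeight, update_nil_collisions, update_nil_pairs]

/-- The probability of an event that depends on the realizations of `T` rounds. -/
noncomputable def prob (K T : ℕ) (P : List (Realization d K) → Prop) : ℝ :=
  open Classical in 𝔼 Φ : Fin T → Realization d K, if P (List.ofFn Φ) then 1 else 0

lemma prob_le_expect {T : ℕ} {P : List (Realization d K) → Prop}
    {F : List (Realization d K) → ℝ} (h0 : ∀ φs, 0 ≤ F φs)
    (h1 : ∀ φs, φs.length = T → P φs → 1 ≤ F φs) :
    prob K T P ≤ 𝔼 Φ : Fin T → Realization d K, F (List.ofFn Φ) := by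
  refine Finset.expect_le_expect fun Φ _ => ?_
  split_ifs with h
  · exact h1 _ (by simp) h
  · exact h0 _

lemma prob_le_one [∀ i, NeZero (d i)] (T : ℕ) (P : List (Realization d K) → Prop) :
    prob K T P ≤ 1 := by
  simpa using prob_le_expect (K := K) (T := T) (P := P) (F := fun _ => 1) (by simp) (by simp)

/-- Chernoff bound with `l = 4 ε σ`. On the event, with `p` pairs, the exponent of the weight is at
least `4 ε² p - 2 ε² p = 2 ε² p`. This grows with `p ≥ T - 1`, so one `l` serves every value of the
random `p` and no union bound over `p` is needed. -/
lemma prob_deviation_le [∀ i, NeZero (d i)] {A : Learner d} (hA : IsFullInfoCLCB A)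
    (hK : m ≤ K) (i : Fin m) {σ ε : ℝ} (hσ : σ ^ 2 = 1) (hε : 0 ≤ ε) (T : ℕ) :
    prob K T (fun φs => ε ≤ σ * (muHat (feedback A φs) i - mu d i))
      ≤ Real.exp (-2 * ε ^ 2 * (T - 1 : ℕ)) := by
  -- With fewer than two rounds there may be no pair; the bound is then `1`.
  rcases Nat.lt_or_ge T 2 with hT | hT
  · rw [show T - 1 = 0 by omega]
    simpa using prob_le_one T _
  have key : prob K T (fun φs => ε ≤ σ * (muHat (feedback A φs) i - mu d i))
      ≤ 𝔼 Φ : Fin T → Realization d K, Real.exp (-2 * ε ^ 2 * (T - 1 : ℕ)) *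
        expWeight (4 * ε * σ) (4 * ε * σ * mu d i + (4 * ε * σ) ^ 2 / 8)
          (stats (feedback A (List.ofFn Φ)) i) := by
    refine prob_le_expect (F := fun φs => Real.exp (-2 * ε ^ 2 * (T - 1 : ℕ)) *
        expWeight (4 * ε * σ) (4 * ε * σ * mu d i + (4 * ε * σ) ^ 2 / 8)
          (stats (feedback A φs) i)) (fun φs => ?_) fun φs hl h => ?_
    · unfold expWeight; positivity
    obtain ⟨hv, hr⟩ := stats_feedback_valid hA hK i φs
    have hp := hv.rounds_le
    rw [hr, hl] at hp
    rw [muHat] at h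
    rw [expWeight, ← Real.exp_add]
    generalize (stats (feedback A φs) i).collisions = X at *
    generalize (stats (feedback A φs) i).pairs = p at *
    have hp0 : (0 : ℝ) < p := by exact_mod_cast (by omega : 0 < p)
    have hTp : ((T - 1 : ℕ) : ℝ) ≤ p := by exact_mod_cast (by omega : T - 1 ≤ p)
    have h2 : ε * p ≤ σ * (X - mu d i * p) := by
      calc ε * p ≤ (σ * (X / p - mu d i)) * p := mul_le_mul_of_nonneg_right h hp0.le
        _ = _ := by field_simp
    apply Real.one_le_exp
    have h3 : 4 * ε * (ε * p) ≤ 4 * ε * (σ * (X - mu d i * p)) :=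
      mul_le_mul_of_nonneg_left h2 (by linarith)
    have h4 : ε ^ 2 * (T - 1 : ℕ) ≤ ε ^ 2 * p := mul_le_mul_of_nonneg_left hTp (sq_nonneg _)
    have h5 : (4 * ε * σ) ^ 2 / 8 = 2 * ε ^ 2 := by linear_combination 2 * ε ^ 2 * hσ
    rw [h5]
    nlinarith
  refine key.trans ?_
  rw [← Finset.mul_expect]
  exact mul_le_of_le_one_right (Real.exp_nonneg _) (expect_expWeight_le_one hA hK i _ T)

/-! ### Comparison of two policies within a round -/

/-- All members have been met. -/
def Full (ψ : PartialRealization d) : Prop := ∀ i, met ψ i = d i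

lemma Full.extend {ψ : PartialRealization d} (h : Full ψ) (i : Fin m) (v : Fin (d i)) :
    Full (extend ψ i v) := fun j =>
  le_antisymm (met_le _ j) ((h j).symm.le.trans (met_le_met_extend ψ i v j))

lemma Full.totalMet_eq {ψ : PartialRealization d} (h : Full ψ) : totalMet ψ = ∑ i, (d i : ℝ) := by
  simp [totalMet, h _]

/-- After `m` steps both policies have explored each community once, whatever the order. From there
they observe the same as long as they agree, and once everything has been met the choices no longer
matter. -/
lemma totalMet_trajectory_eq {π π' : Policy d} (h : PrefersUnexplored π)
    (h' : PrefersUnexplored π') (hK : m ≤ K) (φ : Realization d K)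
    (hagree : ∀ s, m ≤ s → s < K →
      π (trajectory π' φ s) = π' (trajectory π' φ s) ∨ Full (trajectory π' φ s)) :
    totalMet (trajectory π φ K) = totalMet (trajectory π' φ K) := by
  have key : ∀ s, m ≤ s → s ≤ K → explored π φ s = explored π' φ s ∨
      (Full (trajectory π φ s) ∧ Full (trajectory π' φ s)) := by
    intro s hs
    induction s, hs using Nat.le_induction with
    | base => exact fun _ => Or.inl (by rw [explored_eq_one h φ hK, explored_eq_one h' φ hK])
    | succ s hs ih =>
      intro hsK
      obtain ⟨v, hv⟩ := exists_trajectory_succ π φ (s := s) (by omega)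
      obtain ⟨v', hv'⟩ := exists_trajectory_succ π' φ (s := s) (by omega)
      rw [hv, hv']
      rcases ih (by omega) with he | ⟨h1, h2⟩
      · have ht : trajectory π φ s = trajectory π' φ s := by rw [trajectory, he, trajectory]
        rcases hagree s hs (by omega) with ha | ha
        · left
          rw [explored_succ, explored_succ, he, ht, ha]
        · exact Or.inr ⟨Full.extend (ht ▸ ha) _ _, ha.extend _ _⟩
      · exact Or.inr ⟨h1.extend _ _, h2.extend _ _⟩
  rcases key K hK le_rfl with he | ⟨h1, h2⟩
  · rw [trajectory, he, trajectory]
  · rw [h1.totalMet_eq, h2.totalMet_eq]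

lemma mu_pos [∀ i, NeZero (d i)] (i : Fin m) : 0 < mu d i := by
  have := NeZero.pos (d i)
  unfold mu; positivity

lemma met_eq_zero_iff {ψ : PartialRealization d} {i : Fin m} : met ψ i = 0 ↔ ψ i = [] := by
  simp [met]

lemma IsGreedy.prefersUnexplored [∀ i, NeZero (d i)] {πg : Policy d} (hg : IsGreedy πg) :
    PrefersUnexplored πg := by
  rintro ψ ⟨j, hj⟩
  have h := hg.isBest ψ j
  rw [met_eq_zero_iff.2 hj, Nat.cast_zero, mul_zero] at h
  rw [← met_eq_zero_iff]
  have h2 := nonpos_of_mul_nonpos_right h (mu_pos _)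
  exact_mod_cast le_antisymm h2 (Nat.cast_nonneg _)

lemma expectedReward_nonneg (K : ℕ) (π : Policy d) : 0 ≤ expectedReward K π :=
  Finset.expect_nonneg fun _ _ => Finset.sum_nonneg fun _ _ => Nat.cast_nonneg _

lemma met_trajectory_zero (π : Policy d) (φ : Realization d K) : met (trajectory π φ 0) = 0 := by
  rw [trajectory_zero]; ext; simp [met]

/-! ### The greedy chain -/

section Greedy

variable [∀ i, NeZero (d i)]

lemma met_observed_distinctRealization {k : Fin m → ℕ} {i : Fin m} (hK : k i ≤ K)
    (hd : k i ≤ d i) : met (observed (distinctRealization d K) k) i = k i := by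
  rw [met, List.toFinset_card_of_nodup]
  · simp [observed, hK]
  · rw [List.nodup_iff_injective_getElem]
    intro a b hab
    have ha : (a : ℕ) < k i := lt_of_lt_of_le a.2 (by simp [observed])
    have hb : (b : ℕ) < k i := lt_of_lt_of_le b.2 (by simp [observed])
    have := congrArg Fin.val hab
    simp only [observed, distinctRealization, List.getElem_take, List.getElem_ofFn,
      Fin.val_ofNat] at this
    rw [Nat.mod_eq_of_lt (by omega), Nat.mod_eq_of_lt (by omega)] at this
    exact Fin.ext this

/-- A greedy policy selects an exhausted community only if all are exhausted, which takes `D` steps.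
So up to step `D` the repetitions in `distinctRealization` are never reached. -/
lemma IsGreedy.explored_distinctRealization_le {πg : Policy d} (hg : IsGreedy πg) {s : ℕ}
    (hK : s ≤ K) (hD : s ≤ ∑ i, d i) (i : Fin m) :
    explored πg (distinctRealization d K) s i ≤ d i := by
  induction s generalizing i with
  | zero => simp [explored]
  | succ s ih =>
    have ih := ih (by omega) (by omega)
    have hmet : ∀ i, met (trajectory πg (distinctRealization d K) s) i
        = explored πg (distinctRealization d K) s i := fun i =>
      met_observed_distinctRealization ((explored_le _ _ _ _).trans (by omega)) (ih i)
    rw [explored_succ, Pi.add_apply]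
    by_cases hi : i = πg (trajectory πg (distinctRealization d K) s)
    · rw [← hi, Pi.single_eq_same]
      by_contra! hlt
      have heq : explored πg (distinctRealization d K) s i = d i :=
        le_antisymm (ih i) (by omega)
      have hfull : ∀ j, d j ≤ explored πg (distinctRealization d K) s j := by
        intro j
        have h := hg.isBest (trajectory πg (distinctRealization d K) s) j
        rw [← hi, hmet, hmet, heq] at h
        have hi0 : (0 : ℝ) < d i := by exact_mod_cast NeZero.pos (d i)
        have hj0 : (0 : ℝ) < d j := by exact_mod_cast NeZero.pos (d j)
        unfold mu at h
        rw [one_div_mul_cancel hi0.ne', one_div_mul_eq_div, one_le_div hj0] at h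
        exact_mod_cast h
      have := Finset.sum_le_sum fun j (_ : j ∈ Finset.univ) => hfull j
      rw [sum_explored] at this
      omega
    · rw [Pi.single_eq_of_ne hi]
      exact ih i

lemma U_eq (K : ℕ) (πg : Policy d) (k : ℕ) :
    U K πg k = explored πg (distinctRealization d K) (k - 1) := rfl

lemma U_one (K : ℕ) (πg : Policy d) : U K πg 1 = 0 := rfl

lemma sum_U (K : ℕ) (πg : Policy d) (k : ℕ) : ∑ i, U K πg k i = k - 1 := by
  simp [U_eq, sum_explored]

/-- The choice of `πg` depends only on the numbers met, so the chain can be continued from any `ψ`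
with these numbers. -/
lemma IsGreedy.U_succ {πg : Policy d} (hg : IsGreedy πg) {k : ℕ} (h1 : 1 ≤ k)
    (hk : k ≤ min K (∑ i, d i)) {ψ : PartialRealization d} (hψ : met ψ = U K πg k) :
    U K πg (k + 1) = U K πg k + Pi.single (πg ψ) 1 := by
  obtain ⟨s, rfl⟩ : ∃ s, k = s + 1 := ⟨k - 1, by omega⟩
  simp only [U_eq, Nat.add_sub_cancel] at hψ ⊢
  rw [explored_succ, hg.2 _ ψ]
  rw [hψ]
  ext i
  exact met_observed_distinctRealization ((explored_le _ _ _ _).trans (by omega))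
    (hg.explored_distinctRealization_le (by omega) (by omega) i)

lemma IsGreedy.met_extend_eq_U {πg : Policy d} (hg : IsGreedy πg) {k : ℕ} (h1 : 1 ≤ k)
    (hk : k ≤ min K (∑ i, d i)) {ψ : PartialRealization d} (hψ : met ψ = U K πg k)
    (v : Fin (d (πg ψ))) :
    met (CommunityExploration.extend ψ (πg ψ) v) = U K πg k ∨
      met (CommunityExploration.extend ψ (πg ψ) v) = U K πg (k + 1) := by
  rw [met_extend, hg.U_succ h1 hk hψ, hψ]
  split_ifs <;> simp

lemma IsGreedy.full_of_met_eq_U {πg : Policy d} (hg : IsGreedy πg) (hD : ∑ i, d i ≤ K)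
    {ψ : PartialRealization d} (hψ : met ψ = U K πg (∑ i, d i + 1)) : Full ψ := by
  intro i
  rw [hψ]
  have hs : ∑ i, U K πg (∑ i, d i + 1) i = ∑ i, d i := by simp [sum_U]
  exact (Finset.sum_eq_sum_iff_of_le fun i _ =>
    hg.explored_distinctRealization_le (by omega) (by omega) i).1 hs i (Finset.mem_univ i)

/-- Strictly below `U K πg k₀` a policy in `Π_{k₀}` copies `πg`, so the numbers met cannot leave the
chain. -/
lemma exists_met_eq_U_of_lt {πg π : Policy d} (hg : IsGreedy πg) {k₀ : ℕ}
    (hk : k₀ ≤ min K (∑ i, d i)) (h0 : 1 ≤ k₀) (hπ : π ∈ policiesAgreeing K πg k₀)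
    (φ : Realization d K) {s : ℕ} (hs : s ≤ K) (hlt : met (trajectory π φ s) < U K πg k₀) :
    ∃ k, 1 ≤ k ∧ k < k₀ ∧ met (trajectory π φ s) = U K πg k := by
  induction s with
  | zero =>
    refine ⟨1, le_rfl, lt_of_le_of_ne h0 ?_, by rw [met_trajectory_zero, U_one]⟩
    rintro rfl
    rw [met_trajectory_zero, U_one] at hlt
    exact lt_irrefl _ hlt
  | succ s ih =>
    obtain ⟨v, hv⟩ := exists_trajectory_succ π φ (s := s) (by omega)
    have hlt' : met (trajectory π φ s) < U K πg k₀ :=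
      (met_le_met_extend _ _ v).trans_lt (hv ▸ hlt)
    obtain ⟨k, h1, h2, h3⟩ := ih (by omega) hlt'
    have hpi : π (trajectory π φ s) = πg (trajectory π φ s) :=
      hπ _ hlt'.le (Pi.lt_def.1 hlt').2
    rw [hv] at hlt ⊢
    revert v
    rw [hpi]
    intro v hlt _
    rcases hg.met_extend_eq_U h1 (by omega) h3 v with h | h
    · exact ⟨k, h1, h2, h⟩
    · refine ⟨k + 1, by omega, lt_of_le_of_ne h2 ?_, h⟩
      rintro rfl
      exact hlt.ne h

lemma exists_met_greedy_eq_U {πg : Policy d} (hg : IsGreedy πg) (φ : Realization d K) {s : ℕ}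
    (hs : s ≤ K) :
    ∃ k, 1 ≤ k ∧ k ≤ min s (∑ i, d i) + 1 ∧ met (trajectory πg φ s) = U K πg k := by
  induction s with
  | zero => exact ⟨1, le_rfl, by simp, by rw [met_trajectory_zero, U_one]⟩
  | succ s ih =>
    obtain ⟨v, hv⟩ := exists_trajectory_succ πg φ (s := s) (by omega)
    obtain ⟨k, h1, h2, h3⟩ := ih (by omega)
    rw [hv]
    by_cases hk : k ≤ ∑ i, d i
    · rcases hg.met_extend_eq_U h1 (by omega) h3 v with h | h
      · exact ⟨k, h1, by omega, h⟩
      · exact ⟨k + 1, by omega, by omega, h⟩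
    -- The chain ends at level `D + 1`, where all members have been met.
    · have hkD : k = ∑ i, d i + 1 := by omega
      subst hkD
      have hf := hg.full_of_met_eq_U (by omega) h3
      refine ⟨_, h1, by omega, ?_⟩
      rw [← h3]
      ext i
      rw [hf.extend _ v i, hf i]

/-- `π` differs from `πg` where the numbers of members met are those of the greedy chain at `k`. -/
def Deviates (K : ℕ) (πg π : Policy d) (k : ℕ) : Prop :=
  ∃ ψ, met ψ = U K πg k ∧ π ψ ≠ πg ψ

/-- From step `m` on every community has been met, so the entries of `U K πg k`, whose sum is `k -
1`, are all positive. This is why only levels above `m` count. -/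
lemma le_of_met_eq_U {πg π : Policy d} (h : PrefersUnexplored π) (φ : Realization d K) {s k : ℕ}
    (hm : m ≤ s) (hs : s ≤ K) (h1 : 1 ≤ k) (hk : met (trajectory π φ s) = U K πg k) :
    m + 1 ≤ k := by
  have : ∑ _i : Fin m, 1 ≤ ∑ i, U K πg k i := Finset.sum_le_sum fun i _ => by
    rw [← hk, Nat.one_le_iff_ne_zero, Ne, met_eq_zero_iff]
    exact trajectory_ne_nil h φ hm hs i
  rw [sum_U] at this
  simp at this
  omega

lemma expectedReward_eq_of_not_deviates {πg π : Policy d} (hg : IsGreedy πg)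
    (h : PrefersUnexplored π) (hK : m ≤ K)
    (hdev : ∀ k ∈ Finset.Icc (m + 1) (min K (∑ i, d i)), ¬ Deviates K πg π k) :
    expectedReward K π = expectedReward K πg := by
  refine Finset.expect_congr rfl fun φ _ =>
    totalMet_trajectory_eq h hg.prefersUnexplored hK φ fun s hm hs => ?_
  obtain ⟨k, h1, h2, h3⟩ := exists_met_greedy_eq_U hg φ hs.le
  by_cases hk : k ≤ ∑ i, d i
  · left
    by_contra hne
    exact hdev k (Finset.mem_Icc.2
      ⟨le_of_met_eq_U hg.prefersUnexplored φ hm hs.le h1 h3, by omega⟩) ⟨_, h3, hne⟩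
  · right
    have hkD : k = ∑ i, d i + 1 := by omega
    exact hg.full_of_met_eq_U (by omega) (hkD ▸ h3)

/-- Replacing `π` by `πg` strictly below `U K πg k₀` gives a policy in `Π_{k₀}`. From step `m` on,
the replacement is felt only at chain states of level below `k₀`, where `π` agrees with `πg` anyway.
-/
lemma exists_mem_policiesAgreeing {πg π : Policy d} (hg : IsGreedy πg)
    (h : PrefersUnexplored π) (hK : m ≤ K) {k₀ : ℕ}
    (hk₀ : k₀ ∈ Finset.Icc (m + 1) (min K (∑ i, d i)))
    (hdev : ∀ k, m + 1 ≤ k → k < k₀ → ¬ Deviates K πg π k) :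
    ∃ π' ∈ policiesAgreeing K πg k₀, expectedReward K π' = expectedReward K π := by
  classical
  rw [Finset.mem_Icc] at hk₀
  let π' : Policy d := fun ψ => if met ψ < U K πg k₀ then πg ψ else π ψ
  have hπ' : π' ∈ policiesAgreeing K πg k₀ := fun ψ h1 h2 => if_pos (Pi.lt_def.2 ⟨h1, h2⟩)
  have hpref : PrefersUnexplored π' := fun ψ hψ => by
    by_cases hlt : met ψ < U K πg k₀
    · rw [show π' ψ = πg ψ from if_pos hlt]
      exact hg.prefersUnexplored ψ hψ
    · rw [show π' ψ = π ψ from if_neg hlt]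
      exact h ψ hψ
  refine ⟨π', hπ', Eq.symm <| Finset.expect_congr rfl fun φ _ =>
    totalMet_trajectory_eq h hpref hK φ fun s hm hs => Or.inl ?_⟩
  by_cases hlt : met (trajectory π' φ s) < U K πg k₀
  · obtain ⟨k, h1, h2, h3⟩ := exists_met_eq_U_of_lt hg hk₀.2 (by omega) hπ' φ hs.le hlt
    have hk := hdev k (le_of_met_eq_U hpref φ hm hs.le h1 h3) h2
    rw [show π' (trajectory π' φ s) = πg (trajectory π' φ s) from if_pos hlt]
    by_contra hne
    exact hk ⟨_, h3, hne⟩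
  · exact (if_neg hlt).symm

lemma le_deltaMax {πg π : Policy d} {k : ℕ} (h : π ∈ policiesAgreeing K πg k) :
    expectedReward K πg - expectedReward K π ≤ deltaMax K πg k := by
  refine le_csSup ⟨expectedReward K πg, ?_⟩ ⟨π, h, rfl⟩
  rintro _ ⟨π', -, rfl⟩
  linarith [expectedReward_nonneg K π']

lemma deltaMax_nonneg (πg : Policy d) (k : ℕ) : 0 ≤ deltaMax K πg k := by
  simpa using le_deltaMax (K := K) (πg := πg) (π := πg) (k := k) fun _ _ _ => rfl

-- The least level of deviation alone bounds the loss; the sum over all levels is a weaker form that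
-- can be averaged level by level.
open Classical in
lemma IsGreedy.expectedReward_sub_le {πg π : Policy d} (hg : IsGreedy πg)
    (h : PrefersUnexplored π) (hK : m ≤ K) :
    expectedReward K πg - expectedReward K π ≤
      ∑ k ∈ Finset.Icc (m + 1) (min K (∑ i, d i)),
        if Deviates K πg π k then deltaMax K πg k else 0 := by
  have hnn : ∀ k ∈ Finset.Icc (m + 1) (min K (∑ i, d i)),
      0 ≤ if Deviates K πg π k then deltaMax K πg k else 0 := fun k _ => by
    split_ifs
    · exact deltaMax_nonneg πg k
    · exact le_rfl
  by_cases hex : ∃ k, k ∈ Finset.Icc (m + 1) (min K (∑ i, d i)) ∧ Deviates K πg π k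
  · obtain ⟨hk, hdev⟩ := Nat.find_spec hex
    obtain ⟨π', hπ', he⟩ := exists_mem_policiesAgreeing hg h hK hk fun k h1 h2 hd =>
      Nat.find_min hex h2 ⟨by rw [Finset.mem_Icc] at hk ⊢; omega, hd⟩
    rw [← he]
    refine (le_deltaMax hπ').trans ?_
    refine le_trans (le_of_eq ?_) (Finset.single_le_sum hnn hk)
    rw [if_pos hdev]
  · push Not at hex
    rw [expectedReward_eq_of_not_deviates hg h hK hex, sub_self]
    exact Finset.sum_nonneg hnn

end Greedy

/-! ### The regret -/

section Regret

variable [∀ i, NeZero (d i)]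

/-- The realization of a round is independent of the earlier feedback, so averaging over it first
turns rewards into expected rewards. -/
lemma regret_eq_sum (πstar : Policy d) (A : Learner d) (T : ℕ) :
    regret K πstar A T = ∑ t ∈ Finset.range T, 𝔼 Φ : Fin t → Realization d K,
      (expectedReward K πstar - expectedReward K (A (feedback A (List.ofFn Φ)))) := by
  induction T with
  | zero => simp [regret]
  | succ T ih =>
    have htake : ∀ (Φ : Fin (T + 1) → Realization d K) (t : ℕ), t ≤ T →
        (List.ofFn Φ).take t = (List.ofFn fun s : Fin T => Φ s.castSucc).take t := by
      intro Φ t ht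
      rw [List.ofFn_succ', List.concat_eq_append, List.take_append_of_le_length (by simpa)]
    rw [Finset.sum_range_succ, ← ih, regret]
    simp_rw [Fin.sum_univ_castSucc]
    rw [Finset.expect_add_distrib]
    congr 1
    · simp_rw [fun Φ (t : Fin T) => htake Φ t.castSucc t.2.le]
      rw [expect_fin_succ T fun (Φ : Fin T → Realization d K) _ => ∑ t : Fin T,
        (reward (explored πstar (Φ t) K) (Φ t) - reward (explored
          (A (feedback A ((List.ofFn Φ).take (t.castSucc : Fin (T + 1))))) (Φ t) K) (Φ t))]
      simp_rw [Fintype.expect_const]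
      rfl
    · simp_rw [fun Φ => htake Φ (Fin.last T) le_rfl]
      rw [expect_fin_succ T fun (Φ : Fin T → Realization d K) φ =>
        reward (explored πstar φ K) φ - reward (explored
          (A (feedback A ((List.ofFn Φ).take (Fin.last T : Fin (T + 1))))) φ K) φ]
      refine Finset.expect_congr rfl fun Φ _ => ?_
      rw [Finset.expect_sub_distrib, List.take_of_length_le (by simp)]
      rfl

/-- Geometric series: with `x = 2 ε²`, `exp (-x) ≤ 1 / (1 + x)` and `1 / (1 - 1 / (1 + x)) = 1 + 1 /
x`. -/
lemma sum_exp_le {ε : ℝ} (hε : 0 < ε) (T : ℕ) :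
    ∑ t ∈ Finset.range T, Real.exp (-2 * ε ^ 2 * t) ≤ 1 + 1 / (2 * ε ^ 2) := by
  have hx : 0 < 2 * ε ^ 2 := by positivity
  have hq : Real.exp (-2 * ε ^ 2) ≤ 1 / (1 + 2 * ε ^ 2) := by
    rw [neg_mul, Real.exp_neg, ← one_div]
    exact one_div_le_one_div_of_le (by positivity) (by linarith [Real.add_one_le_exp (2 * ε ^ 2)])
  have hq1 : Real.exp (-2 * ε ^ 2) < 1 :=
    hq.trans_lt ((div_lt_one (by linarith)).2 (by linarith))
  calc ∑ t ∈ Finset.range T, Real.exp (-2 * ε ^ 2 * t)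
      = ∑ t ∈ Finset.range T, Real.exp (-2 * ε ^ 2) ^ t := by
        refine Finset.sum_congr rfl fun t _ => ?_
        rw [← Real.exp_nat_mul, mul_comm]
    _ ≤ ∑' t : ℕ, Real.exp (-2 * ε ^ 2) ^ t :=
        (summable_geometric_of_lt_one (Real.exp_nonneg _) hq1).sum_le_tsum _
          fun t _ => by positivity
    _ = (1 - Real.exp (-2 * ε ^ 2))⁻¹ := tsum_geometric_of_lt_one (Real.exp_nonneg _) hq1
    _ ≤ (1 - 1 / (1 + 2 * ε ^ 2))⁻¹ := by
        refine inv_anti₀ ?_ (by linarith)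
        rw [sub_pos, div_lt_one (by linarith)]
        linarith
    _ = 1 + 1 / (2 * ε ^ 2) := by
        have : 1 - 1 / (1 + 2 * ε ^ 2) = 2 * ε ^ 2 / (1 + 2 * ε ^ 2) := by field_simp; ring
        rw [this, inv_div]
        field_simp
        ring

/-- The mean number of rounds in which some empirical mean is far off is bounded. -/
lemma sum_prob_le {A : Learner d} (hA : IsFullInfoCLCB A) (hK : m ≤ K) {P : Feedback d → Prop}
    {S : Finset (Fin m)} {ε : Fin m → ℝ} (j : Fin m → Fin m) (hε : ∀ i ∈ S, 0 < ε i)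
    (hP : ∀ h, P h → ∃ i ∈ S, ε i ≤ muHat h (j i) - mu d (j i) ∨ ε i ≤ -(muHat h i - mu d i))
    (T : ℕ) :
    ∑ t ∈ Finset.range T, prob K t (fun φs : List (Realization d K) => P (feedback A φs))
      ≤ 1 + ∑ i ∈ S, (2 + 1 / ε i ^ 2) := by
  classical
  -- After `t + 1` rounds there are at least `t` pairs; a union bound over `S` and the two kinds of
  -- error gives the factor `2`.
  have hone : ∀ t, prob K (t + 1) (fun φs : List (Realization d K) => P (feedback A φs))
      ≤ ∑ i ∈ S, 2 * Real.exp (-2 * ε i ^ 2 * t) := by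
    intro t
    let Q : Fin m → List (Realization d K) → Prop := fun i φs =>
      ε i ≤ 1 * (muHat (feedback A φs) (j i) - mu d (j i))
    let R : Fin m → List (Realization d K) → Prop := fun i φs =>
      ε i ≤ -1 * (muHat (feedback A φs) i - mu d i)
    calc prob K (t + 1) (fun φs : List (Realization d K) => P (feedback A φs))
        ≤ 𝔼 Φ : Fin (t + 1) → Realization d K, ∑ i ∈ S,
          ((if Q i (List.ofFn Φ) then (1 : ℝ) else 0) + if R i (List.ofFn Φ) then 1 else 0) := by
          have hnn : ∀ φs i, (0 : ℝ) ≤ (if Q i φs then 1 else 0) + if R i φs then 1 else 0 :=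
            fun φs i => by positivity
          refine prob_le_expect (F := fun φs => ∑ i ∈ S,
            ((if Q i φs then (1 : ℝ) else 0) + if R i φs then 1 else 0))
            (fun φs => Finset.sum_nonneg fun i _ => hnn φs i) fun φs _ h => ?_
          obtain ⟨i, hi, h⟩ := hP _ h
          refine le_trans ?_ (Finset.single_le_sum (fun i _ => hnn φs i) hi)
          rcases h with h | h
          · rw [if_pos (show Q i φs by simpa [Q] using h)]
            exact le_add_of_nonneg_right (by positivity)
          · rw [if_pos (show R i φs by simpa [R] using h)]
            exact le_add_of_nonneg_left (by positivity)
      _ = ∑ i ∈ S, (prob K (t + 1) (Q i) + prob K (t + 1) (R i)) := by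
          rw [Finset.expect_sum_comm]
          refine Finset.sum_congr rfl fun i _ => ?_
          rw [Finset.expect_add_distrib]
          simp only [prob]
      _ ≤ _ := by
          refine Finset.sum_le_sum fun i hi => ?_
          have h1 := prob_deviation_le hA hK (j i) (σ := 1) (by norm_num) (hε i hi).le (t + 1)
          have h2 := prob_deviation_le hA hK i (σ := -1) (by norm_num) (hε i hi).le (t + 1)
          rw [Nat.add_sub_cancel] at h1 h2
          linarith
  have hrhs : 0 ≤ ∑ i ∈ S, (2 + 1 / ε i ^ 2) := Finset.sum_nonneg fun i _ => by positivity
  cases T with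
  | zero => simp only [Finset.range_zero, Finset.sum_empty]; linarith
  | succ T =>
    -- The first round is played without feedback and is charged `1`.
    rw [Finset.sum_range_succ', add_comm]
    refine add_le_add (prob_le_one _ _) ?_
    calc _ ≤ ∑ t ∈ Finset.range T, ∑ i ∈ S, 2 * Real.exp (-2 * ε i ^ 2 * t) :=
          Finset.sum_le_sum fun t _ => hone t
      _ ≤ _ := by
          rw [Finset.sum_comm]
          refine Finset.sum_le_sum fun i hi => ?_
          rw [← Finset.mul_sum]
          have h := sum_exp_le (hε i hi) T
          have e : 2 + 1 / ε i ^ 2 = 2 * (1 + 1 / (2 * ε i ^ 2)) := by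
            have := hε i hi
            field_simp
          linarith

/-- A choice that is not greedy requires an estimate that is off by a fixed amount. -/
lemma exists_deviation_of_not_isBest {A : Learner d} (hA : IsFullInfoCLCB A) {h : Feedback d}
    (hne : ¬ ∀ ψ, IsBest ψ (A h ψ)) :
    ∃ i ∈ Finset.univ, 1 / (4 * (∑ i, (d i : ℝ)) ^ 3) ≤ muHat h i - mu d i ∨
      1 / (4 * (∑ i, (d i : ℝ)) ^ 3) ≤ -(muHat h i - mu d i) := by
  unfold IsBest at hne
  push Not at hne
  obtain ⟨ψ, j, hj⟩ := hne
  by_contra! hcon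
  set D : ℝ := ∑ i, (d i : ℝ) with hD
  have hsum := (hA h ψ).1 j
  generalize A h ψ = a at *
  have hdD : ∀ i, (d i : ℝ) ≤ D := fun i =>
    Finset.single_le_sum (f := fun i => (d i : ℝ)) (fun _ _ => Nat.cast_nonneg _)
      (Finset.mem_univ i)
  have hd1 : ∀ i, (1 : ℝ) ≤ d i := fun i => by exact_mod_cast NeZero.one_le
  have hD1 : 1 ≤ D := (hd1 a).trans (hdD a)
  have hc : ∀ i, (met ψ i : ℝ) ≤ D := fun i =>
    le_trans (by exact_mod_cast met_le ψ i) (hdD i)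
  -- The difference is positive with an integer numerator over `d a * d j ≤ D ^ 2`.
  have hgap : 1 / D ^ 2 ≤ mu d a * met ψ a - mu d j * met ψ j := by
    have ha0 := lt_of_lt_of_le one_pos (hd1 a)
    have hj0 := lt_of_lt_of_le one_pos (hd1 j)
    have e : mu d a * met ψ a - mu d j * met ψ j
        = ((met ψ a * d j : ℕ) - (met ψ j * d a : ℕ) : ℝ) / (d a * d j) := by
      push_cast; unfold mu; field_simp
    have hnum : (1 : ℝ) ≤ (met ψ a * d j : ℕ) - (met ψ j * d a : ℕ) := by
      have h0 : (0 : ℝ) < ((met ψ a * d j : ℕ) - (met ψ j * d a : ℕ) : ℝ) / (d a * d j) := by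
        rw [← e]; linarith
      have h1 : ((met ψ j * d a : ℕ) : ℝ) < (met ψ a * d j : ℕ) := by
        have := (div_pos_iff_of_pos_right (mul_pos ha0 hj0)).1 h0
        linarith
      have h2 : ((met ψ j * d a : ℕ) : ℝ) + 1 ≤ (met ψ a * d j : ℕ) := by
        exact_mod_cast Nat.cast_lt.1 h1
      linarith
    rw [e]
    refine div_le_div₀ (by linarith) hnum (mul_pos ha0 hj0) ?_
    nlinarith [hdD a, hdD j]
  -- Each error shifts an index by at most `1 / (4 D²)`; together they cover only half of the gap.
  have h1 : (met ψ a : ℝ) * (mu d a - muHat h a) ≤ D * (1 / (4 * D ^ 3)) :=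
    (mul_le_mul_of_nonneg_left (by linarith [(hcon a (Finset.mem_univ a)).2])
      (Nat.cast_nonneg _)).trans (mul_le_mul_of_nonneg_right (hc a) (by positivity))
  have h2 : (met ψ j : ℝ) * (muHat h j - mu d j) ≤ D * (1 / (4 * D ^ 3)) :=
    (mul_le_mul_of_nonneg_left (by linarith [(hcon j (Finset.mem_univ j)).1])
      (Nat.cast_nonneg _)).trans (mul_le_mul_of_nonneg_right (hc j) (by positivity))
  have h3 : D * (1 / (4 * D ^ 3)) = 1 / 4 * (1 / D ^ 2) := by field_simp
  have h4 : 0 < 1 / D ^ 2 := by positivity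
  rw [h3] at h1 h2
  linarith

/-- The regret is bounded by a constant. -/
lemma regret_le_const {πstar : Policy d} {A : Learner d} (hA : IsFullInfoCLCB A) (hK : m ≤ K)
    (T : ℕ) :
    regret K πstar A T ≤ expectedReward K πstar *
      (1 + ∑ _i : Fin m, (2 + 1 / (1 / (4 * (∑ i, (d i : ℝ)) ^ 3)) ^ 2)) := by
  classical
  rcases isEmpty_or_nonempty (Fin m) with hm | hm
  · exact hm.elim (πstar fun _ => [])
  have hD : 0 < ∑ i, (d i : ℝ) := Finset.sum_pos
    (fun i _ => by exact_mod_cast NeZero.pos (d i)) Finset.univ_nonempty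
  have h0 := expectedReward_nonneg K πstar
  have hbad := sum_prob_le hA hK (P := fun h => ¬ ∀ ψ, IsBest ψ (A h ψ))
    (ε := fun _ => 1 / (4 * (∑ i, (d i : ℝ)) ^ 3)) id (fun _ _ => by positivity)
    (fun h hne => exists_deviation_of_not_isBest hA hne) T
  refine le_trans ?_ (mul_le_mul_of_nonneg_left hbad h0)
  rw [regret_eq_sum, Finset.mul_sum]
  refine Finset.sum_le_sum fun t _ => ?_
  rw [prob, Finset.mul_expect]
  refine Finset.expect_le_expect fun Φ _ => ?_
  -- If every choice is best, the policy is optimal and the round costs nothing, however ties are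
  -- broken.
  by_cases h : ∀ ψ, IsBest ψ (A (feedback A (List.ofFn Φ)) ψ)
  · have := isOptimal_of_isBest K h πstar
    rw [if_neg (not_not.2 h)]
    linarith
  · have := expectedReward_nonneg K (A (feedback A (List.ofFn Φ)))
    rw [if_pos h]
    linarith

/-- The gap `ε_{i,k}` as a real number. -/
noncomputable def epsReal (K : ℕ) (πg : Policy d) (k : ℕ) (istar i : Fin m) : ℝ :=
  (mu d i * U K πg k i - mu d istar * U K πg k istar)
    / ((U K πg k i : ℝ) + (U K πg k istar : ℝ))

lemma exists_deviation_of_deviates {A : Learner d} (hA : IsFullInfoCLCB A) {h : Feedback d}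
    {πg : Policy d} (hg : IsGreedy πg) {k : ℕ} {istar : Fin m}
    (hε : ∀ i ∈ Finset.univ.erase istar, 0 < epsReal K πg k istar i)
    (hdev : Deviates K πg (A h) k) :
    ∃ i ∈ Finset.univ.erase istar, epsReal K πg k istar i ≤ muHat h istar - mu d istar ∨
      epsReal K πg k istar i ≤ -(muHat h i - mu d i) := by
  obtain ⟨ψ, hψ, hne⟩ := hdev
  have hden : ∀ i, i ≠ istar → (0 : ℝ) < (U K πg k i : ℝ) + (U K πg k istar : ℝ) ∧
      mu d istar * U K πg k istar < mu d i * U K πg k i := by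
    intro i hi
    have hpos := hε i (Finset.mem_erase.2 ⟨hi, Finset.mem_univ i⟩)
    have hnn : (0 : ℝ) ≤ (U K πg k i : ℝ) + (U K πg k istar : ℝ) := by positivity
    rcases hnn.eq_or_lt with h0 | h0
    · simp [epsReal, ← h0] at hpos
    · refine ⟨h0, ?_⟩
      have := (div_pos_iff_of_pos_right h0).1 hpos
      linarith
  -- Positive gaps make the minimizer unique, so `πg` must select it.
  have hstar : πg ψ = istar := by
    by_contra hi
    have h1 := hg.isBest ψ istar
    rw [hψ] at h1
    linarith [(hden _ hi).2]
  rw [hstar] at hne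
  refine ⟨A h ψ, Finset.mem_erase.2 ⟨hne, Finset.mem_univ _⟩, ?_⟩
  by_contra! hcon
  have h1 := (hA h ψ).1 istar
  rw [hψ] at h1
  generalize A h ψ = a at *
  have he : epsReal K πg k istar a * ((U K πg k a : ℝ) + (U K πg k istar : ℝ))
      = mu d a * U K πg k a - mu d istar * U K πg k istar :=
    div_mul_cancel₀ _ (hden a hne).1.ne'
  have hs : (0 : ℝ) ≤ U K πg k istar := Nat.cast_nonneg _
  have ha : (0 : ℝ) ≤ U K πg k a := Nat.cast_nonneg _
  have h2 : (U K πg k a : ℝ) * (mu d a - muHat h a) ≤ U K πg k a * epsReal K πg k istar a :=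
    mul_le_mul_of_nonneg_left (by linarith [hcon.2]) ha
  have h3 : (U K πg k istar : ℝ) * (muHat h istar - mu d istar)
      ≤ U K πg k istar * epsReal K πg k istar a :=
    mul_le_mul_of_nonneg_left hcon.1.le hs
  -- Strictness is taken from an error whose coefficient is positive; the coefficients have a
  -- positive sum.
  rcases ha.eq_or_lt with h0 | h0
  · have h4 : (0 : ℝ) < U K πg k istar := by linarith [(hden a hne).1]
    have := mul_lt_mul_of_pos_left hcon.1 h4
    linarith
  · have := mul_lt_mul_of_pos_left
      (show mu d a - muHat h a < epsReal K πg k istar a by linarith [hcon.2]) h0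
    linarith

lemma epsReal_le_one (πg : Policy d) (k : ℕ) (istar i : Fin m) :
    epsReal K πg k istar i ≤ 1 := by
  refine div_le_one_of_le₀ ?_ (by positivity)
  have h1 : mu d i * U K πg k i ≤ U K πg k i :=
    mul_le_of_le_one_left (Nat.cast_nonneg _) (mu_le_one i)
  have h2 : 0 ≤ mu d istar * U K πg k istar := mul_nonneg (mu_nonneg _) (Nat.cast_nonneg _)
  have h3 : (0 : ℝ) ≤ U K πg k istar := Nat.cast_nonneg _
  linarith

/-- With `y = 1 / ε² ≥ 1` this is `2 + y ≤ 2 y² + 1`: summing the tails gives order `1 / ε²`, weaker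
than the stated `1 / ε⁴`. -/
lemma two_add_inv_sq_le {ε : ℝ} (h0 : 0 < ε) (h1 : ε ≤ 1) :
    2 + 1 / ε ^ 2 ≤ 2 / ε ^ 4 + 1 := by
  have h2 : 1 ≤ 1 / ε ^ 2 := by
    rw [le_div_iff₀ (by positivity)]; nlinarith
  have h3 : 2 / ε ^ 4 = 2 * (1 / ε ^ 2) ^ 2 := by field_simp
  rw [h3]
  nlinarith

open Classical in
lemma regret_le_sum_deltaMax {πstar πg : Policy d} (hopt : IsOptimal K πstar) (hg : IsGreedy πg)
    {A : Learner d} (hA : IsFullInfoCLCB A) (hK : m ≤ K) (T : ℕ) :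
    regret K πstar A T ≤ ∑ k ∈ Finset.Icc (m + 1) (min K (∑ i, d i)),
      (∑ t ∈ Finset.range T, prob K t (fun φs : List (Realization d K) =>
        Deviates K πg (A (feedback A φs)) k)) * deltaMax K πg k := by
  have hr : expectedReward K πstar = expectedReward K πg :=
    le_antisymm (isOptimal_of_isBest K hg.isBest πstar) (hopt πg)
  rw [regret_eq_sum, hr]
  simp_rw [Finset.sum_mul]
  rw [Finset.sum_comm]
  refine Finset.sum_le_sum fun t _ => ?_
  simp_rw [prob, Finset.expect_mul]
  rw [← Finset.expect_sum_comm]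
  refine Finset.expect_le_expect fun Φ _ => ?_
  refine (hg.expectedReward_sub_le (hA.prefersUnexplored _) hK).trans (le_of_eq ?_)
  refine Finset.sum_congr rfl fun k _ => ?_
  rw [ite_mul, one_mul, zero_mul]

lemma sum_prob_deviates_le {πg : Policy d} (hg : IsGreedy πg) {A : Learner d}
    (hA : IsFullInfoCLCB A) (hK : m ≤ K) (k : ℕ) (istar : Fin m) (T : ℕ) :
    ENNReal.ofReal ((∑ t ∈ Finset.range T, prob K t (fun φs : List (Realization d K) =>
        Deviates K πg (A (feedback A φs)) k)) * deltaMax K πg k)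
      ≤ ∑ i, (2 / eps K πg k istar i ^ 4 + 1) * ENNReal.ofReal (deltaMax K πg k) := by
  rw [ENNReal.ofReal_mul' (deltaMax_nonneg πg k), ← Finset.sum_mul]
  -- A zero loss is settled first, because of `∞ * 0 = 0`.
  rcases (deltaMax_nonneg (K := K) πg k).eq_or_lt with h0 | h0
  · simp [← h0]
  refine mul_le_mul_left ?_ _
  have heps : ∀ i ∈ Finset.univ.erase istar,
      eps K πg k istar i = ENNReal.ofReal (epsReal K πg k istar i) := fun i hi =>
    if_neg (Finset.ne_of_mem_erase hi)
  by_cases hε : ∀ i ∈ Finset.univ.erase istar, 0 < epsReal K πg k istar i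
  · have h := sum_prob_le hA hK (P := fun h => Deviates K πg (A h) k) (fun _ => istar) hε
      (fun h hdev => exists_deviation_of_deviates hA hg hε hdev) T
    refine (ENNReal.ofReal_le_ofReal h).trans ?_
    -- The `1` charged to the first round is the term of `istar`, where `2 / ∞ + 1 = 1`.
    rw [← Finset.add_sum_erase _ _ (Finset.mem_univ istar),
      ENNReal.ofReal_add zero_le_one (Finset.sum_nonneg fun i hi => by positivity),
      ENNReal.ofReal_sum_of_nonneg (fun i hi => by positivity)]
    refine add_le_add (by simp [eps]) (Finset.sum_le_sum fun i hi => ?_)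
    rw [heps i hi]
    have hi0 := hε i hi
    refine (ENNReal.ofReal_le_ofReal
      (two_add_inv_sq_le hi0 (epsReal_le_one πg k istar i))).trans ?_
    rw [ENNReal.ofReal_add (by positivity) zero_le_one, ENNReal.ofReal_div_of_pos (by positivity),
      ENNReal.ofReal_pow hi0.le]
    simp
  -- A gap that is not positive is truncated to `0`, and its term `2 / 0` makes the bound infinite.
  · push Not at hε
    obtain ⟨i, hi, hle⟩ := hε
    refine le_trans ?_ (Finset.single_le_sum (fun _ _ => zero_le) (Finset.mem_univ i))
    rw [heps i hi, ENNReal.ofReal_of_nonpos hle, zero_pow four_ne_zero,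
      ENNReal.div_zero two_ne_zero, top_add]
    exact le_top

end Regret

/-! ### Randomized algorithms and the final bounds -/

lemma integral_le_of_forall_le {Ξ : Type*} [MeasurableSpace Ξ] (ν : Measure Ξ)
    [IsProbabilityMeasure ν] {f : Ξ → ℝ} {C : ℝ} (hC : 0 ≤ C) (h : ∀ ξ, f ξ ≤ C) :
    ∫ ξ, f ξ ∂ν ≤ C := by
  by_cases hf : Integrable f ν
  · simpa using integral_mono hf (integrable_const C) h
  -- A non-integrable function has integral `0` by convention, hence the need for `0 ≤ C`.
  · rwa [integral_undef hf]

end CommunityExploration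

open CommunityExploration in
theorem theorem6 {m : ℕ} (d : Fin m → ℕ) [∀ i, NeZero (d i)] (K : ℕ) (hK : m < K)
    (πstar : Policy d) (hopt : IsOptimal K πstar) :
    (∃ C : ℝ, ∀ (Ξ : Type*) [MeasurableSpace Ξ] (ν : Measure Ξ) [IsProbabilityMeasure ν]
      (A : Ξ → Learner d), (∀ ξ, IsFullInfoCLCB (A ξ)) →
      (∀ h ψ, Measurable (fun ξ => A ξ h ψ)) →
      ∀ T : ℕ, randomizedRegret ν K πstar A T ≤ C) ∧
    (∀ πg : Policy d, IsGreedy πg →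
      ∀ istar : ℕ → Fin m,
      (∀ k ∈ Finset.Icc (m + 1) (min K (∑ i, d i)), IsArgmin K πg k (istar k)) →
      ∀ (Ξ : Type*) [MeasurableSpace Ξ] (ν : Measure Ξ) [IsProbabilityMeasure ν]
      (A : Ξ → Learner d), (∀ ξ, IsFullInfoCLCB (A ξ)) →
      (∀ h ψ, Measurable (fun ξ => A ξ h ψ)) →
      ∀ T : ℕ, ENNReal.ofReal (randomizedRegret ν K πstar A T) ≤
        ∑ i : Fin m, ∑ k ∈ Finset.Icc (m + 1) (min K (∑ j, d j)),
          (2 / eps K πg k (istar k) i ^ 4 + 1) * ENNReal.ofReal (deltaMax K πg k)) := by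
  refine ⟨⟨expectedReward K πstar *
      (1 + ∑ _i : Fin m, (2 + 1 / (1 / (4 * (∑ i, (d i : ℝ)) ^ 3)) ^ 2)), ?_⟩, ?_⟩
  · intro Ξ _ ν _ A hA _ T
    exact integral_le_of_forall_le ν (mul_nonneg (expectedReward_nonneg K πstar) (by positivity))
      fun ξ => regret_le_const (hA ξ) hK.le T
  · intro πg hg istar _ Ξ _ ν _ A hA _ T
    rw [Finset.sum_comm]
    set B := ∑ k ∈ Finset.Icc (m + 1) (min K (∑ j, d j)), ∑ i : Fin m,
      (2 / eps K πg k (istar k) i ^ 4 + 1) * ENNReal.ofReal (deltaMax K πg k)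
    have h : ∀ ξ, ENNReal.ofReal (regret K πstar (A ξ) T) ≤ B := fun ξ =>
      (ENNReal.ofReal_le_ofReal (regret_le_sum_deltaMax hopt hg (hA ξ) hK.le T)).trans <|
        (Finset.le_sum_of_subadditive _ ENNReal.ofReal_zero.le
          (fun _ _ => ENNReal.ofReal_add_le) _ _).trans <| Finset.sum_le_sum fun k _ =>
            sum_prob_deviates_le hg (hA ξ) hK.le k (istar k) T
    -- The bound holds for each seed; only a finite `B` can be moved to the reals and integrated.
    rcases eq_or_ne B ⊤ with hB | hB
    · simp [hB]
    · refine ENNReal.ofReal_le_of_le_toReal ?_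
      exact integral_le_of_forall_le ν ENNReal.toReal_nonneg fun ξ =>
        (ENNReal.ofReal_le_iff_le_toReal hB).1 (h ξ)
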